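/- All graphs are finite and simple. For an integer $d\ge 1$, a graph is called $d$-degenerate if each of its (non-null) subgraphs contains a vertex whose degree in that subgraph is at most $d$; let $\mathcal F_d$ be the family of all $d$-degenerate graphs. For a graph $G$ and a family $\mathcal F$ of graphs, let $f(n,G\mid\mathcal F)$ denote the smallest positive integer $k$ such that every coloring of the edges of the complete graph $K_n$ that uses at least $k$ colors contains a copy of $G$ in which, for each color occurring in the copy, the edges of that color induce (together with their endpoints) a graph belonging to $\mathcal F$. Let $\mathrm{ex}(n,H)$ denote the Turán number, that is, the maximum number of edges in a graph on $n$ vertices that contains no copy of $H$ as a (not necessarily induced) subgraph. **Theorem.** Let $d\ge 1$ and $p\ge 2d+3$ be fixed integers. Then, as $n\to\infty$, $$ f(n,K_p\mid\mathcal F_d) = (1+o(1))\,\mathrm{ex}\bigl(n,K_{\lceil p/(d+1)\rceil}\bigr). $$ -/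

import Mathlib

namespace ColorClassRamsey

/-- A graph `G` is `d`-degenerate if every (non-null) subgraph of `G` contains a vertex whose
degree in that subgraph is at most `d`. -/
def IsDegenerate (d : ℕ) {V : Type} (G : SimpleGraph V) : Prop :=
  ∀ H : G.Subgraph, H.verts.Nonempty → ∃ v ∈ H.verts, (H.neighborSet v).encard ≤ d

/-- A family (class) of graphs. -/
abbrev GraphFamily : Type 1 := ∀ V : Type, SimpleGraph V → Prop

/-- The family of finite `d`-degenerate graphs. -/
def degenerateFamily (d : ℕ) : GraphFamily := fun V G => Finite V ∧ IsDegenerate d G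

/-- The number of colors that are actually used by an edge coloring of `K_n`. -/
noncomputable def numColors {n : ℕ} (C : SimpleGraph.TopEdgeLabeling (Fin n) ℕ) : ℕ :=
  {c : ℕ | ∃ e, C e = c}.ncard

/-- The subgraph induced by the edges of color `c` in a subgraph `H` of the edge-colored graph
`K_n`: its edges are the edges of `H` of color `c`, its vertices are the ends of these edges. -/
def colorClass {n : ℕ} (C : SimpleGraph.TopEdgeLabeling (Fin n) ℕ)
    (H : (⊤ : SimpleGraph (Fin n)).Subgraph) (c : ℕ) : (⊤ : SimpleGraph (Fin n)).Subgraph where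
  verts := {v | ∃ w, H.Adj v w ∧ (C.labelGraph c).Adj v w}
  Adj v w := H.Adj v w ∧ (C.labelGraph c).Adj v w
  adj_sub h := H.adj_sub h.1
  edge_vert h := ⟨_, h⟩
  symm := ⟨fun _ _ h => ⟨h.1.symm, h.2.symm⟩⟩

/-- Every color that occurs on an edge of `H` induces in `H` a member of the family `F`. -/
def IsFamilyColored (F : GraphFamily) {n : ℕ} (C : SimpleGraph.TopEdgeLabeling (Fin n) ℕ)
    (H : (⊤ : SimpleGraph (Fin n)).Subgraph) : Prop :=
  ∀ c : ℕ, (∃ v w, (colorClass C H c).Adj v w) →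
    F (colorClass C H c).verts (colorClass C H c).coe

/-- Every edge coloring of `K_n` that uses at least `k` colors contains a copy of `G` in which
each color class is a member of `F`. -/
def Forces (F : GraphFamily) {W : Type} (G : SimpleGraph W) (n k : ℕ) : Prop :=
  ∀ C : SimpleGraph.TopEdgeLabeling (Fin n) ℕ, k ≤ numColors C →
    ∃ H : (⊤ : SimpleGraph (Fin n)).Subgraph, Nonempty (G ≃g H.coe) ∧ IsFamilyColored F C H

/-- `f(n, G | F)`: the smallest positive integer `k` such that every edge coloring of `K_n` with
at least `k` colors contains a copy of `G` in which each color class is a member of `F`. -/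
noncomputable def forcingNumber (F : GraphFamily) {W : Type} (G : SimpleGraph W) (n : ℕ) : ℕ :=
  sInf {k : ℕ | 1 ≤ k ∧ Forces F G n k}

/-- The minimum that defines `forcingNumber` is attained. -/
theorem isLeast_forcingNumber (F : GraphFamily) {W : Type} (G : SimpleGraph W) (n : ℕ) :
    IsLeast {k : ℕ | 1 ≤ k ∧ Forces F G n k} (forcingNumber F G n) := by
  have hne : {k : ℕ | 1 ≤ k ∧ Forces F G n k}.Nonempty := by
    refine ⟨Nat.card (⊤ : SimpleGraph (Fin n)).edgeSet + 1, Nat.le_add_left 1 _, fun C hC => ?_⟩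
    have h : numColors C ≤ Nat.card (⊤ : SimpleGraph (Fin n)).edgeSet := by
      have := Set.ncard_image_le (s := (Set.univ : Set (⊤ : SimpleGraph (Fin n)).edgeSet))
        (f := fun e => C e) Set.finite_univ
      rw [Set.image_univ, Set.ncard_univ] at this
      exact this
    omega
  exact ⟨Nat.sInf_mem hne, fun _ hk => Nat.sInf_le hk⟩

end ColorClassRamsey

/-! ### Quadratic bounds for Turán numbers -/

namespace SimpleGraph

open Finset Filter

/-! Write `⌈p/(d+1)⌉ = s + 1`. Lower bound: give the edges of the Turán graph with `s` parts
distinct colors and all other edges one further color; by pigeonhole every `K_p` has `d + 2`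
vertices in one part, hence a monochromatic `K_{d+2}` (`not_forces_degenerateFamily`). Upper bound:
pick one edge of each color. With enough colors this rainbow graph contains a complete `(s +
1)`-partite graph with parts of size `d + 1`, and any `p` of its vertices span a suitable `K_p`
(`forces_degenerateFamily`). By Erdős-Stone both bounds are `(1 - 1/s + o(1)) n²/2`. -/

/-- If every `H`-free graph on `n + 1` vertices has minimum degree at most `b`, then the extremal
number of `H` increases by at most `b` from `n` to `n + 1`. -/
theorem extremalNumber_succ_le_add {W : Type*} {H : SimpleGraph W} {n : ℕ} {b : ℝ} (hb : 0 ≤ b)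
    (h : ∀ (G : SimpleGraph (Fin (n + 1))) [DecidableRel G.Adj], H.Free G → (G.minDegree : ℝ) ≤ b) :
    (extremalNumber (n + 1) H : ℝ) ≤ extremalNumber n H + b := by
  have key := extremalNumber_le_iff_of_nonneg (V := Fin (n + 1)) H
    (m := (extremalNumber n H + b : ℝ)) (by positivity)
  rw [Fintype.card_fin] at key
  refine key.2 fun G _ hG => ?_
  obtain ⟨v, hv⟩ := G.exists_minimal_degree_vertex
  have h1 := card_edgeFinset_deleteIncidenceSet_le_extremalNumber hG v
  rw [Fintype.card_fin, Nat.add_sub_cancel] at h1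
  have h2 := G.card_edgeFinset_deleteIncidenceSet v
  have h3 : #G.edgeFinset ≤ extremalNumber n H + G.minDegree := by omega
  calc (#G.edgeFinset : ℝ) ≤ extremalNumber n H + G.minDegree := mod_cast h3
    _ ≤ _ := by gcongr; exact h G hG

/-- The edge version of the **Erdős-Stone theorem**, with an explicit quadratic bound. -/
theorem exists_extremalNumber_completeEquipartiteGraph_le {ε : ℝ} (hε : 0 < ε) {s : ℕ}
    (hs : 1 ≤ s) (t : ℕ) :
    ∃ A : ℝ, ∀ᶠ n : ℕ in atTop, (extremalNumber n (completeEquipartiteGraph (s + 1) t) : ℝ) ≤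
      A + (1 - 1 / s + ε) * (n * (n + 1) / 2) := by
  obtain ⟨N, hN⟩ := eventually_atTop.1
    (eventually_completeEquipartiteGraph_isContained_of_minDegree hε s t)
  have hc : (0 : ℝ) ≤ 1 - 1 / s := by
    rw [sub_nonneg, div_le_one (by positivity)]
    exact_mod_cast hs
  refine ⟨extremalNumber N (completeEquipartiteGraph (s + 1) t), ?_⟩
  filter_upwards [eventually_ge_atTop N] with n hn
  -- The minimum-degree form holds only from `N` on; each later vertex adds at most `(1 - 1/s + ε)(n
  -- + 1)` edges, and these sum to at most the quadratic term.
  induction n, hn using Nat.le_induction with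
  | base => exact le_add_of_nonneg_right (by positivity)
  | succ n hn ih =>
    have h1 := extremalNumber_succ_le_add (H := completeEquipartiteGraph (s + 1) t) (n := n)
      (b := (1 - 1 / s + ε) * (n + 1)) (by positivity) fun G _ hG => by
        by_contra! hlt
        refine hG (hN (n + 1) (by omega) ?_)
        push_cast
        exact hlt.le
    push_cast
    linarith

theorem le_card_edgeFinset_turanGraph (n : ℕ) {s : ℕ} (hs : 1 ≤ s) :
    (1 - 1 / s : ℝ) * (n ^ 2 / 2) - (s ^ 2 + 1) ≤ #(turanGraph n s).edgeFinset := by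
  have hs0 : (0 : ℝ) < s := by exact_mod_cast hs
  have hs1 : (1 : ℝ) ≤ s := by exact_mod_cast hs
  rw [card_edgeFinset_turanGraph]
  have hmn : (n % s) ^ 2 ≤ n ^ 2 := Nat.pow_le_pow_left (Nat.mod_le n s) 2
  have hms : ((n % s : ℕ) : ℝ) ^ 2 ≤ (s : ℝ) ^ 2 := by
    gcongr
    exact (Nat.mod_lt n hs).le
  have hfloor : (((n ^ 2 - (n % s) ^ 2) * (s - 1) : ℕ) : ℝ) / ((2 * s : ℕ) : ℝ) - 1 ≤
      (((n ^ 2 - (n % s) ^ 2) * (s - 1) / (2 * s) : ℕ) : ℝ) := by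
    rw [← Nat.floor_div_eq_div (K := ℝ)]
    exact (Nat.sub_one_lt_floor _).le
  rw [Nat.cast_mul, Nat.cast_sub hmn, Nat.cast_sub hs] at hfloor
  push_cast at hfloor ⊢
  have heq : ((n : ℝ) ^ 2 - ((n % s : ℕ) : ℝ) ^ 2) * (s - 1) / (2 * s) =
      (1 - 1 / s) * (n ^ 2 / 2) - (1 - 1 / s) * (((n % s : ℕ) : ℝ) ^ 2 / 2) := by
    field_simp
  have hc1 : (1 - 1 / s : ℝ) ≤ 1 := by
    have : (0 : ℝ) ≤ 1 / s := by positivity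
    linarith
  have hle : (1 - 1 / s : ℝ) * (((n % s : ℕ) : ℝ) ^ 2 / 2) ≤ (s : ℝ) ^ 2 := by
    calc (1 - 1 / s : ℝ) * (((n % s : ℕ) : ℝ) ^ 2 / 2) ≤ (1 : ℝ) * (((n % s : ℕ) : ℝ) ^ 2 / 2) := by
          gcongr
      _ ≤ (s : ℝ) ^ 2 := by nlinarith
  have hch : (0 : ℝ) ≤ ((n % s).choose 2 : ℕ) := Nat.cast_nonneg _
  linarith

end SimpleGraph

/-! ### Degeneracy, the two colorings bounds, and the asymptotics -/

namespace ColorClassRamsey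

open Finset Filter SimpleGraph

theorem IsDegenerate.cliqueFree {d : ℕ} {V : Type} {G : SimpleGraph V} (h : IsDegenerate d G) :
    G.CliqueFree (d + 2) := by
  intro T hT
  have hne : T.Nonempty := by
    rw [← Finset.card_pos, hT.card_eq]
    omega
  obtain ⟨v, hv, hdeg⟩ := h ((⊤ : G.Subgraph).induce (T : Set V)) (by simpa using hne)
  have hvT : v ∈ T := by simpa using hv
  classical
  have hsub : ((T.erase v : Finset V) : Set V) ⊆
      ((⊤ : G.Subgraph).induce (T : Set V)).neighborSet v := by
    intro w hw
    obtain ⟨hwv, hwT⟩ := Finset.mem_erase.1 (Finset.mem_coe.1 hw)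
    simp only [Subgraph.mem_neighborSet, Subgraph.induce_adj, Subgraph.top_adj]
    exact ⟨hvT, hwT, hT.isClique hvT hwT (Ne.symm hwv)⟩
  have hle := (Set.encard_le_encard hsub).trans hdeg
  rw [Set.encard_coe_eq_coe_finsetCard, Finset.card_erase_of_mem hvT, hT.card_eq] at hle
  have : d + 2 - 1 ≤ d := by exact_mod_cast hle
  omega

/-- A graph whose vertices are partitioned into parts of at most `d + 1` vertices, with at most one
edge between different parts, is `d`-degenerate. -/
theorem isDegenerate_of_parts {d : ℕ} (hd : 1 ≤ d) {V ι : Type} {G : SimpleGraph V} (f : V → ι)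
    (hf : ∀ v, {w | f w = f v}.encard ≤ (d + 1 : ℕ))
    (hcross : ∀ v w v' w', G.Adj v w → f v ≠ f w → G.Adj v' w' → f v' ≠ f w' →
      s(v, w) = s(v', w')) : IsDegenerate d G := by
  intro K hK
  by_contra! hdeg
  -- A vertex of degree above `d` and its neighbors do not fit into one part. So every vertex of `K`
  -- is an end of the only cross edge, and degrees are at most `1 ≤ d`.
  have hex : ∀ v ∈ K.verts, ∃ w, K.Adj v w ∧ f v ≠ f w := by
    intro v hv
    by_contra! hall
    have hsub : insert v (K.neighborSet v) ⊆ {w | f w = f v} := by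
      rintro w (rfl | hw)
      · rfl
      · exact (hall w hw).symm
    have h1 := (Set.encard_le_encard hsub).trans (hf v)
    have hv' : v ∉ K.neighborSet v := fun h => (K.adj_sub h).ne rfl
    rw [Set.encard_insert_of_notMem hv', Nat.cast_add,
      Nat.cast_one, ENat.add_le_add_iff_right ENat.one_ne_top] at h1
    exact (hdeg v hv).not_ge h1
  obtain ⟨a, ha⟩ := hK
  obtain ⟨b, hab, hfab⟩ := hex a ha
  refine (hdeg a ha).not_ge ?_
  have hsub : K.neighborSet a ⊆ {b} := by
    intro w hw
    have hwK : K.Adj w a := K.adj_symm hw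
    obtain ⟨w', hww', hfw⟩ := hex w (K.edge_vert hwK)
    have h := hcross _ _ _ _ (K.adj_sub hab) hfab (K.adj_sub hww') hfw
    have hwa : w ≠ a := (K.adj_sub hw).ne'
    rw [Sym2.eq_iff] at h
    rcases h with h | h
    · exact absurd h.1.symm hwa
    · exact h.2.symm
  refine (Set.encard_le_encard hsub).trans ?_
  rw [Set.encard_singleton]
  exact_mod_cast hd

theorem colorClass_adj {n : ℕ} (C : TopEdgeLabeling (Fin n) ℕ)
    (H : (⊤ : SimpleGraph (Fin n)).Subgraph) (c : ℕ) (v w : Fin n) :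
    (colorClass C H c).Adj v w ↔ H.Adj v w ∧ ∃ h : v ≠ w, C.get v w h = c := by
  rw [← TopEdgeLabeling.labelGraph_adj]
  rfl

/-- Every edge coloring has a rainbow graph that uses every color exactly once. -/
theorem exists_rainbow_graph {n : ℕ} (C : TopEdgeLabeling (Fin n) ℕ) :
    ∃ (G : SimpleGraph (Fin n)) (_ : DecidableRel G.Adj), #G.edgeFinset = numColors C ∧
      ∀ v w v' w' (h : G.Adj v w) (h' : G.Adj v' w'),
        C.get v w h.ne = C.get v' w' h'.ne → s(v, w) = s(v', w') := by
  classical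
  let g : Set.range C → (⊤ : SimpleGraph (Fin n)).edgeSet := Set.rangeSplitting C
  have hg : ∀ x, C (g x) = x := Set.apply_rangeSplitting C
  have hginj : Function.Injective fun x => (g x : Sym2 (Fin n)) :=
    Subtype.val_injective.comp (Set.rangeSplitting_injective C)
  let G : SimpleGraph (Fin n) := fromEdgeSet (Set.range fun x => (g x : Sym2 (Fin n)))
  have hG : G.edgeSet = Set.range fun x => (g x : Sym2 (Fin n)) := by
    rw [edgeSet_fromEdgeSet, sdiff_eq_left, Set.disjoint_left]
    rintro _ ⟨x, rfl⟩ hdiag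
    exact not_isDiag_of_mem_edgeSet _ (g x).2 hdiag
  refine ⟨G, inferInstance, ?_, ?_⟩
  · rw [← Set.ncard_coe_finset, coe_edgeFinset, hG, ← Set.image_univ,
      Set.ncard_image_of_injective _ hginj, Set.ncard_univ]
    rfl
  · have hmem : ∀ v w (h : G.Adj v w), ∃ x : Set.range C, (g x : Sym2 (Fin n)) = s(v, w) ∧
        (x : ℕ) = C.get v w h.ne := by
      intro v w h
      have h2 : s(v, w) ∈ G.edgeSet := h
      rw [hG] at h2
      obtain ⟨x, hx⟩ := h2
      refine ⟨x, hx, ?_⟩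
      rw [← hg x, EdgeLabeling.get_eq]
      congr 1
      exact Subtype.ext hx
    intro v w v' w' h h' hC
    obtain ⟨x, hx, hxC⟩ := hmem v w h
    obtain ⟨y, hy, hyC⟩ := hmem v' w' h'
    rw [← hx, ← hy, Subtype.ext (hxC.trans (hC.trans hyC.symm))]

/-- Edges between parts lie in the rainbow graph, so a color class has at most one of them; edges
inside parts may have any colors. -/
theorem forces_degenerateFamily {d r p n : ℕ} (hd : 1 ≤ d) (hp : p ≤ r * (d + 1)) :
    Forces (degenerateFamily d) (⊤ : SimpleGraph (Fin p)) n
      (extremalNumber n (completeEquipartiteGraph r (d + 1)) + 1) := by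
  intro C hC
  obtain ⟨G, _, hcard, hrainbow⟩ := exists_rainbow_graph C
  obtain ⟨f⟩ : completeEquipartiteGraph r (d + 1) ⊑ G := by
    apply IsContained.of_extremalNumber_lt_card_edgeFinset
    rw [Fintype.card_fin]
    omega
  obtain ⟨e⟩ : Nonempty (Fin p ↪ Fin r × Fin (d + 1)) := by
    rw [Function.Embedding.nonempty_iff_card_le]
    simpa using hp
  let φ : Fin p ↪ Fin n := e.trans f.toEmbedding
  let H : (⊤ : SimpleGraph (Fin n)).Subgraph := (⊤ : Subgraph ⊤).induce (Set.range φ)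
  have hHadj : ∀ {v w}, H.Adj v w ↔ v ∈ Set.range φ ∧ w ∈ Set.range φ ∧ v ≠ w := by
    intro v w
    simp [H]
  refine ⟨H, ⟨⟨Equiv.ofInjective φ φ.injective, ?_⟩⟩, ?_⟩
  · intro a b
    change H.Adj (φ a) (φ b) ↔ _
    simp [hHadj]
  · intro c _
    refine ⟨inferInstance, ?_⟩
    have hrange : ∀ v : (colorClass C H c).verts, ∃ x, f x = v := by
      rintro ⟨v, w, hvw, -⟩
      obtain ⟨i, hi⟩ := (hHadj.1 hvw).1
      exact ⟨e i, hi⟩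
    choose x hx using hrange
    have hxinj : Function.Injective x := fun v w h => Subtype.ext (by rw [← hx, ← hx, h])
    refine isDegenerate_of_parts hd (fun v => (x v).1) (fun v => ?_) ?_
    · have hinj : Set.InjOn (fun w => (x w).2) {w | (x w).1 = (x v).1} := by
        intro w hw w' hw' h
        exact hxinj (Prod.ext (hw.trans hw'.symm) h)
      rw [← hinj.encard_image]
      refine (Set.encard_le_encard (Set.subset_univ _)).trans ?_
      simp
    · intro v w v' w' hvw hf hvw' hf'
      have hG : ∀ u u', (x u).1 ≠ (x u').1 → G.Adj (u : Fin n) u' := by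
        intro u u' h
        rw [← hx u, ← hx u']
        exact f.toHom.map_adj h
      obtain ⟨-, _, h1⟩ := (colorClass_adj C H c v w).1 hvw
      obtain ⟨-, _, h2⟩ := (colorClass_adj C H c v' w').1 hvw'
      have := hrainbow _ _ _ _ (hG v w hf) (hG v' w' hf') (h1.trans h2.symm)
      apply Sym2.map.injective Subtype.val_injective
      simpa using this

theorem not_forces_degenerateFamily {d s p n : ℕ} (hs : 1 ≤ s) (hp : s * (d + 1) < p) :
    ¬ Forces (degenerateFamily d) (⊤ : SimpleGraph (Fin p)) n #(turanGraph n s).edgeFinset := by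
  classical
  intro hF
  obtain ⟨g, hg⟩ := Countable.exists_injective_nat (Sym2 (Fin n))
  let C : TopEdgeLabeling (Fin n) ℕ := fun e =>
    if (e : Sym2 (Fin n)) ∈ (turanGraph n s).edgeSet then g e + 1 else 0
  have hzero : ∀ v w (h : v ≠ w), C.get v w h = 0 ↔ (v : ℕ) % s = w % s := by
    intro v w h
    have : C.get v w h = if (turanGraph n s).Adj v w then g s(v, w) + 1 else 0 := rfl
    rw [this, ← not_iff_not]
    change _ ↔ (turanGraph n s).Adj v w
    split_ifs with h' <;> simp [h']
  have hcolors : #(turanGraph n s).edgeFinset ≤ numColors C := by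
    rw [← Set.ncard_coe_finset, coe_edgeFinset, numColors,
      ← Set.ncard_image_of_injective _ (Nat.succ_injective.comp hg)]
    refine Set.ncard_le_ncard ?_ (Set.finite_range C)
    rintro _ ⟨e, he, rfl⟩
    exact ⟨⟨e, edgeSet_mono le_top he⟩, if_pos he⟩
  obtain ⟨H, ⟨ψ⟩, hH⟩ := hF C hcolors
  have hHadj : ∀ i j, i ≠ j → H.Adj (ψ i) (ψ j) := fun i j hij => ψ.map_adj_iff.2 hij
  have hψ : Function.Injective fun i => (ψ i : Fin n) := Subtype.val_injective.comp ψ.injective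
  obtain ⟨i, -, hi⟩ := Finset.exists_lt_card_fiber_of_mul_lt_card_of_maps_to
    (s := (univ : Finset (Fin p))) (t := Finset.range s) (n := d + 1)
    (f := fun i => ((ψ i : Fin n) : ℕ) % s) (fun _ _ => Finset.mem_range.2 (Nat.mod_lt _ hs)) (by simpa using hp)
  obtain ⟨T, hT, hTcard⟩ := Finset.exists_subset_card_eq (Nat.succ_le_of_lt hi)
  have hTadj : ∀ a ∈ T, ∀ b ∈ T, a ≠ b → (colorClass C H 0).Adj (ψ a) (ψ b) := by
    intro a ha b hb hab
    have hne : (ψ a : Fin n) ≠ ψ b := fun h => hab (hψ h)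
    refine (colorClass_adj ..).2 ⟨hHadj a b hab, hne, (hzero _ _ hne).2 ?_⟩
    exact (mem_filter.1 (hT ha)).2.trans (mem_filter.1 (hT hb)).2.symm
  -- Only colors that occur in the copy are constrained; the edge `ab` shows that color `0` does.
  obtain ⟨a, ha, b, hb, hab⟩ := Finset.one_lt_card.1 (by omega : 1 < #T)
  have hdeg := (hH 0 ⟨_, _, hTadj a ha b hb hab⟩).2.cliqueFree
  have hverts : ∀ u ∈ T, (ψ u : Fin n) ∈ (colorClass C H 0).verts := by
    intro u hu
    by_cases hua : u = a
    · exact (colorClass C H 0).edge_vert (hTadj u hu b hb (hua ▸ hab))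
    · exact (colorClass C H 0).edge_vert (hTadj u hu a ha hua)
  refine hdeg (T.attach.map ⟨fun u : T => ⟨ψ u, hverts u u.2⟩, fun u u' h =>
    Subtype.ext (hψ (Subtype.mk.inj h))⟩) ⟨?_, by simp [hTcard]⟩
  intro x hx y hy hxy
  simp only [coe_map, Set.mem_image, mem_coe, mem_attach, true_and] at hx hy
  obtain ⟨u, rfl⟩ := hx
  obtain ⟨u', rfl⟩ := hy
  exact hTadj u u.2 u' u'.2 fun h => hxy (by rw [Subtype.ext h])

theorem extremalNumber_le_forcingNumber {d s p n : ℕ} (hs : 1 ≤ s) (hp : s * (d + 1) < p) :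
    extremalNumber n (⊤ : SimpleGraph (Fin (s + 1))) ≤
      forcingNumber (degenerateFamily d) (⊤ : SimpleGraph (Fin p)) n := by
  have : Nontrivial (Fin (s + 1)) := Fin.nontrivial_iff_two_le.2 (by omega)
  rw [extremalNumber_top, Fintype.card_fin, Nat.add_sub_cancel]
  by_contra! hlt
  refine not_forces_degenerateFamily (n := n) hs hp fun C hC => ?_
  exact (isLeast_forcingNumber (degenerateFamily d) (⊤ : SimpleGraph (Fin p)) n).1.2 C
    (hlt.le.trans hC)

theorem isEquivalent_of_bounds {f g : ℕ → ℝ} {c B : ℝ} (hc : 0 < c) (hfg : ∀ n, g n ≤ f n)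
    (hg : ∀ n : ℕ, c * (n ^ 2 / 2) - B ≤ g n)
    (hf : ∀ ε > 0, ∃ A : ℝ, ∀ᶠ n : ℕ in atTop, f n ≤ A + (c + ε) * (n * (n + 1) / 2)) :
    Asymptotics.IsEquivalent atTop f g := by
  refine Asymptotics.isLittleO_iff.2 fun η hη => ?_
  -- This `ε` uses half of the allowed error `η * c * n² / 2`; the other half absorbs the linear and
  -- constant terms.
  obtain ⟨A, hA⟩ := hf (η * c / 2) (by positivity)
  have hlim : Tendsto (fun n : ℕ => (n : ℝ) * (η * c / 4 * n - (c + η * c / 2) / 2)) atTop atTop :=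
    tendsto_natCast_atTop_atTop.atTop_mul_atTop₀ (tendsto_atTop_add_const_right _ _
      (tendsto_natCast_atTop_atTop.const_mul_atTop (by positivity)))
  filter_upwards [hA, hlim.eventually_ge_atTop (A + B + η * B)] with n h1 h2
  have h3 := hg n
  have h4 := mul_le_mul_of_nonneg_left h3 hη.le
  have h5 : η * g n ≤ η * ‖g n‖ := mul_le_mul_of_nonneg_left (Real.le_norm_self _) hη.le
  rw [Pi.sub_apply, Real.norm_of_nonneg (sub_nonneg.2 (hfg n))]
  refine le_trans ?_ h5
  nlinarith

end ColorClassRamsey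

theorem mainTheorem12 (d : ℕ) (hd : 1 ≤ d) (p : ℕ) (hp : 2 * d + 3 ≤ p) :
    Asymptotics.IsEquivalent Filter.atTop
      (fun n : ℕ => (ColorClassRamsey.forcingNumber (ColorClassRamsey.degenerateFamily d)
        (⊤ : SimpleGraph (Fin p)) n : ℝ))
      (fun n : ℕ => (SimpleGraph.extremalNumber n
        (⊤ : SimpleGraph (Fin ⌈(p : ℚ) / ((d : ℚ) + 1)⌉₊)) : ℝ)) := by
  have hd0 : (0 : ℚ) < d + 1 := by positivity
  obtain ⟨s, hs⟩ : ∃ s, ⌈(p : ℚ) / ((d : ℚ) + 1)⌉₊ = s + 1 :=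
    Nat.exists_eq_add_one.2 (Nat.ceil_pos.2 (div_pos (by exact_mod_cast (by omega : 0 < p)) hd0))
  rw [hs]
  have hle : p ≤ (s + 1) * (d + 1) := by
    have h := Nat.le_ceil ((p : ℚ) / ((d : ℚ) + 1))
    rw [hs, div_le_iff₀ hd0] at h
    exact_mod_cast h
  have hlt : s * (d + 1) < p := by
    have h : s < ⌈(p : ℚ) / ((d : ℚ) + 1)⌉₊ := by omega
    rw [Nat.lt_ceil, lt_div_iff₀ hd0] at h
    exact_mod_cast h
  -- Here `2 * d + 3 ≤ p` matters: it makes the density `1 - 1/s` positive, so that lower-order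
  -- errors are negligible.
  have hs2 : 2 ≤ s := by
    by_contra! h
    have : (s + 1) * (d + 1) ≤ 2 * (d + 1) := Nat.mul_le_mul_right _ (by omega)
    omega
  have hc : (0 : ℝ) < 1 - 1 / s := by
    have h : (1 : ℝ) < s := by exact_mod_cast hs2
    rw [sub_pos, div_lt_one (by positivity)]
    exact h
  refine ColorClassRamsey.isEquivalent_of_bounds (B := s ^ 2 + 1) hc (fun n => ?_) (fun n => ?_)
    fun ε hε => ?_
  · exact_mod_cast ColorClassRamsey.extremalNumber_le_forcingNumber (by omega) hlt
  · have : Nontrivial (Fin (s + 1)) := Fin.nontrivial_iff_two_le.2 (by omega)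
    rw [SimpleGraph.extremalNumber_top, Fintype.card_fin, Nat.add_sub_cancel]
    exact SimpleGraph.le_card_edgeFinset_turanGraph n (by omega)
  · obtain ⟨A, hA⟩ := SimpleGraph.exists_extremalNumber_completeEquipartiteGraph_le hε
      (s := s) (by omega) (d + 1)
    refine ⟨A + 1, hA.mono fun n hn => ?_⟩
    have h : ColorClassRamsey.forcingNumber (ColorClassRamsey.degenerateFamily d)
        (⊤ : SimpleGraph (Fin p)) n ≤ _ :=
      (ColorClassRamsey.isLeast_forcingNumber _ _ n).2
        ⟨Nat.le_add_left 1 _, ColorClassRamsey.forces_degenerateFamily hd hle⟩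
    have h' := (Nat.cast_le (α := ℝ)).2 h
    push_cast at h'
    linarith
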